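/- Fix integers $r,n\ge 0$. A generalized partition with $r$ rows is a tuple $\lambda\in\mathbb{Z}^r$ with $\lambda_1\ge\cdots\ge\lambda_r$. Let $\mathcal{A}_r$ be the set of subsets of $\{\pm1,\ldots,\pm r\}$ all of whose elements have the same sign; for $S\in\mathcal{A}_r$ put $\mathbf{e}_S=\sum_{i\in S}\mathbf{e}_i$ if $S$ is positive and $\mathbf{e}_S=-\sum_{i\in S}\mathbf{e}_{-i}$ if $S$ is negative. A skew fluctuating tableau of length $n$ with $r$ rows is a sequence $T=(\lambda^0,\lambda^1,\ldots,\lambda^n)$ of $r$-row generalized partitions such that for each $1\le i\le n$ one has $\lambda^i=\lambda^{i-1}+\mathbf{e}_{w_i}$ for some (necessarily unique) $w_i\in\mathcal{A}_r$; the word $L(T)=w_1\cdots w_n$ is its lattice word. It is called a rectangular fluctuating tableau if $\lambda^0=(0,\ldots,0)$ and $\lambda^n$ is constant, $\lambda^n_1=\cdots=\lambda^n_r$. For $\alpha\in\mathbb{Z}^r$ let $\mathrm{sort}(\alpha)$ be its weakly decreasing rearrangement. Given $T$, set $\lambda^{0,j}=\lambda^j$ for $0\le j\le n$, $\lambda^{i,i}=\lambda^0$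 for $0\le i\le n$, and recursively $$\lambda^{i+1,j+1}=\mathrm{sort}\bigl(\lambda^{i,j+1}+\lambda^{i+1,j}-\lambda^{i,j}\bigr)\qquad(0\le i<j<n).$$ The evacuation of $T$ is the skew fluctuating tableau $$\mathcal{E}(T)=(\lambda^{n,n},\lambda^{n-1,n},\ldots,\lambda^{1,n},\lambda^{0,n}),$$ and the promotion of $T$ is the skew fluctuating tableau $$\mathcal{P}(T)=(\lambda^{1,1},\lambda^{1,2},\ldots,\lambda^{1,n},\lambda^{n})$$ (for $n=0$, $\mathcal{P}(T)=T$). For a word $w_1\cdots w_n$ in $\mathcal{A}_r$ put $\varepsilon(w_1\cdots w_n)=\varepsilon(w_n)\cdots\varepsilon(w_1)$, where $\varepsilon(w)$ is obtained from $w$ by replacing each element $i$ with $\mathrm{sgn}(i)\,(r-|i|+1)$. **Theorem.** Let $T$ be a rectangular fluctuating tableau of length $n$. Then (a) $\mathcal{P}^n(T)=T$; (b) $L(\mathcal{E}(T))=\varepsilon(L(T))$. -/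

import Mathlib

namespace Fluctuating

/-- The alphabet `𝒜_r`: subsets of `{±1, …, ±r}` all of whose elements have the same sign. -/
def Letter (r : ℕ) : Type :=
  {S : Finset ℤ // (∀ x ∈ S, 1 ≤ |x| ∧ |x| ≤ (r : ℤ)) ∧ ((∀ x ∈ S, 0 < x) ∨ (∀ x ∈ S, x < 0))}

/-- The vector `𝐞_S ∈ ℤ^r`: `∑_{i ∈ S} 𝐞_i` if `S` is positive and `-∑_{i ∈ S} 𝐞_{-i}` if `S` is
negative. The index `j : Fin r` stands for the row `j + 1`. -/
def Letter.vec {r : ℕ} (S : Letter r) : Fin r → ℤ := fun j =>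
  (if ((j : ℕ) : ℤ) + 1 ∈ S.1 then 1 else 0) - (if -(((j : ℕ) : ℤ) + 1) ∈ S.1 then 1 else 0)

/-- `lam` is obtained from `mu` by adding or removing a skew column. (The shapes are required
to be weakly decreasing where this is used.) -/
def SkewColumn {r : ℕ} (mu lam : Fin r → ℤ) : Prop :=
  ∃ S : Letter r, lam = mu + S.vec

/-- The weakly decreasing rearrangement of an integer tuple. -/
def sortDesc {r : ℕ} (a : Fin r → ℤ) : Fin r → ℤ := fun j => a (Tuple.sort a j.rev)

/-- The local rule: the lower right corner `μ` of a square with upper left corner `lam`, upper right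
corner `nu` and lower left corner `kap`. -/
def localRule {r : ℕ} (lam nu kap : Fin r → ℤ) : Fin r → ℤ := sortDesc (nu + kap - lam)

/-- An `r`-row skew fluctuating tableau of length `n`: a sequence `λ⁰, …, λⁿ` of generalized
partitions (weakly decreasing tuples in `ℤ^r`), consecutive ones differing by a skew column.
The type is determined by the shapes: `c_i` is the sum of the entries of `λ^i - λ^{i-1}`. -/
@[ext]
structure SkewTableau (r n : ℕ) where
  shape : Fin (n + 1) → Fin r → ℤ
  antitone_shape : ∀ i, Antitone (shape i)
  skewColumn : ∀ i : Fin n, SkewColumn (shape i.castSucc) (shape i.succ)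

/-! Facts needed for the definitions of promotion and evacuation to make sense. -/

theorem Letter.vec_injective {r : ℕ} : Function.Injective (Letter.vec (r := r)) := by
  have key : ∀ S T : Letter r, S.vec = T.vec → ∀ x ∈ S.1, x ∈ T.1 := by
    intro S T h x hx
    obtain ⟨h1, h2⟩ := S.2.1 x hx
    rw [Int.abs_eq_natAbs] at h1 h2
    have hlt : x.natAbs - 1 < r := by omega
    have hj := congrFun h ⟨x.natAbs - 1, hlt⟩
    simp only [Letter.vec] at hj
    rcases lt_or_ge 0 x with hp | hn
    · have e : (((x.natAbs - 1 : ℕ) : ℤ)) + 1 = x := by omega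
      rw [e] at hj
      have hneg : -x ∉ S.1 := by
        intro hx'
        rcases S.2.2 with hs | hs
        · have := hs _ hx'; omega
        · have := hs _ hx; omega
      by_contra hT
      rw [if_pos hx, if_neg hneg, if_neg hT] at hj
      split_ifs at hj
      all_goals omega
    · have e : (((x.natAbs - 1 : ℕ) : ℤ)) + 1 = -x := by omega
      rw [e, neg_neg] at hj
      have hneg : -x ∉ S.1 := by
        intro hx'
        rcases S.2.2 with hs | hs
        · have := hs _ hx; omega
        · have := hs _ hx'; omega
      by_contra hT
      rw [if_pos hx, if_neg hneg, if_neg hT] at hj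
      split_ifs at hj
      all_goals omega
  intro S T h
  exact Subtype.ext (Finset.ext fun x => ⟨key S T h x, key T S h.symm x⟩)

theorem skewColumn_iff {r : ℕ} (mu lam : Fin r → ℤ) :
    SkewColumn mu lam ↔
      (mu ≤ lam ∧ lam ≤ mu + 1) ∨ (lam ≤ mu ∧ mu ≤ lam + 1) := by
  constructor
  · rintro ⟨S, rfl⟩
    rcases S.2.2 with hs | hs
    · left
      constructor <;> intro j <;> simp only [Pi.add_apply, Letter.vec, Pi.one_apply]
      all_goals
        rw [if_neg (c := -(((j : ℕ) : ℤ) + 1) ∈ S.1) (fun h => by have := hs _ h; omega)]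
        split_ifs <;> omega
    · right
      constructor <;> intro j <;> simp only [Pi.add_apply, Letter.vec, Pi.one_apply]
      all_goals
        rw [if_neg (c := ((j : ℕ) : ℤ) + 1 ∈ S.1) (fun h => by have := hs _ h; omega)]
        split_ifs <;> omega
  · rintro (⟨h1, h2⟩ | ⟨h1, h2⟩)
    · refine ⟨⟨(Finset.univ.filter fun j => lam j = mu j + 1).image
        (fun j : Fin r => ((j : ℕ) : ℤ) + 1), ?_, Or.inl ?_⟩, ?_⟩
      · intro x hx
        obtain ⟨j, -, rfl⟩ := Finset.mem_image.1 hx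
        have := j.2
        rw [abs_of_nonneg (by omega)]
        omega
      · intro x hx
        obtain ⟨j, -, rfl⟩ := Finset.mem_image.1 hx
        omega
      · funext j
        have a1 : mu j ≤ lam j := h1 j
        have a2 : lam j ≤ mu j + 1 := h2 j
        have m1 : (((j : ℕ) : ℤ) + 1 ∈ (Finset.univ.filter fun j => lam j = mu j + 1).image
            (fun j : Fin r => ((j : ℕ) : ℤ) + 1)) ↔ lam j = mu j + 1 := by
          simp [Fin.val_inj]
        have m2 : ¬ (-(((j : ℕ) : ℤ) + 1) ∈ (Finset.univ.filter fun j => lam j = mu j + 1).image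
            (fun j : Fin r => ((j : ℕ) : ℤ) + 1)) := by
          intro h
          obtain ⟨k, -, hk⟩ := Finset.mem_image.1 h
          omega
        simp only [Pi.add_apply, Letter.vec]
        rw [if_neg m2]
        simp only [m1]
        split_ifs <;> omega
    · refine ⟨⟨(Finset.univ.filter fun j => mu j = lam j + 1).image
        (fun j : Fin r => -(((j : ℕ) : ℤ) + 1)), ?_, Or.inr ?_⟩, ?_⟩
      · intro x hx
        obtain ⟨j, -, rfl⟩ := Finset.mem_image.1 hx
        have := j.2
        rw [abs_neg, abs_of_nonneg (by omega)]
        omega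
      · intro x hx
        obtain ⟨j, -, rfl⟩ := Finset.mem_image.1 hx
        omega
      · funext j
        have a1 : lam j ≤ mu j := h1 j
        have a2 : mu j ≤ lam j + 1 := h2 j
        have m1 : (-(((j : ℕ) : ℤ) + 1) ∈ (Finset.univ.filter fun j => mu j = lam j + 1).image
            (fun j : Fin r => -(((j : ℕ) : ℤ) + 1))) ↔ mu j = lam j + 1 := by
          simp only [Finset.mem_image, Finset.mem_filter, Finset.mem_univ, true_and]
          constructor
          · rintro ⟨k, hk, hkj⟩
            have : k = j := Fin.ext (by omega)
            exact this ▸ hk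
          · intro h
            exact ⟨j, h, rfl⟩
        have m2 : ¬ (((j : ℕ) : ℤ) + 1 ∈ (Finset.univ.filter fun j => mu j = lam j + 1).image
            (fun j : Fin r => -(((j : ℕ) : ℤ) + 1))) := by
          intro h
          obtain ⟨k, -, hk⟩ := Finset.mem_image.1 h
          omega
        simp only [Pi.add_apply, Letter.vec]
        rw [if_neg m2]
        simp only [m1]
        split_ifs <;> omega

theorem skewColumn_refl {r : ℕ} (mu : Fin r → ℤ) : SkewColumn mu mu :=
  (skewColumn_iff mu mu).2 (Or.inl ⟨le_rfl, fun j => by simp⟩)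

theorem antitone_sortDesc {r : ℕ} (a : Fin r → ℤ) : Antitone (sortDesc a) :=
  fun _ _ h => Tuple.monotone_sort a (Fin.rev_le_rev.2 h)

theorem sortDesc_mono {r : ℕ} {a b : Fin r → ℤ} (h : a ≤ b) : sortDesc a ≤ sortDesc b := by
  intro j
  have hb := (Tuple.lt_card_le_iff_apply_le_of_monotone (f := b ∘ Tuple.sort b) (a := sortDesc b j)
    (j := j.rev) (Tuple.monotone_sort b)).2 le_rfl
  refine (Tuple.lt_card_le_iff_apply_le_of_monotone (f := a ∘ Tuple.sort a) (a := sortDesc b j)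
    (j := j.rev) (Tuple.monotone_sort a)).1 (lt_of_lt_of_le hb ?_)
  have e : ∀ (f : Fin r → ℤ) (s : Equiv.Perm (Fin r)) (c : ℤ),
      (Finset.univ.filter fun i => (f ∘ s) i ≤ c).card
        = (Finset.univ.filter fun i => f i ≤ c).card := fun f s c => by
    rw [← Finset.card_map s.toEmbedding]
    congr 1
    ext i
    simp only [Finset.mem_map_equiv, Finset.mem_filter, Finset.mem_univ, true_and,
      Function.comp_apply, Equiv.apply_symm_apply]
  rw [e, e]
  exact Finset.card_le_card (Finset.monotone_filter_right _ fun i _ hi => (h i).trans hi)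

theorem sortDesc_of_antitone {r : ℕ} {a : Fin r → ℤ} (h : Antitone a) : sortDesc a = a := by
  have h1 : a ∘ (Fin.revPerm : Equiv.Perm (Fin r)) = a ∘ Tuple.sort a :=
    Tuple.comp_sort_eq_comp_iff_monotone.2 fun _ _ hij => h (Fin.rev_le_rev.2 hij)
  funext j
  have := congrFun h1 j.rev
  simpa [sortDesc] using this.symm

/-- If `kap → lam → nu` are skew columns then so are `kap → μ → nu` for `μ` given by the
local rule. -/
theorem localRule_skewColumn {r : ℕ} {lam nu kap : Fin r → ℤ} (hn : Antitone nu)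
    (hk : Antitone kap) (h1 : SkewColumn kap lam) (h2 : SkewColumn lam nu) :
    SkewColumn kap (localRule lam nu kap) ∧ SkewColumn (localRule lam nu kap) nu := by
  have up : ∀ {x : Fin r → ℤ}, Antitone x → Antitone (x + 1) := fun hx _ _ h => by
    simpa using hx h
  have dn : ∀ {x : Fin r → ℤ}, Antitone x → Antitone (x - 1) := fun hx _ _ h => by
    simpa using hx h
  have lo : ∀ {x y : Fin r → ℤ}, Antitone x → x ≤ y → x ≤ sortDesc y := fun hx h => by
    simpa [sortDesc_of_antitone hx] using sortDesc_mono h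
  have hi : ∀ {x y : Fin r → ℤ}, Antitone x → y ≤ x → sortDesc y ≤ x := fun hx h => by
    simpa [sortDesc_of_antitone hx] using sortDesc_mono h
  rw [skewColumn_iff] at h1 h2
  simp only [skewColumn_iff, localRule]
  constructor
  · rcases h2 with ⟨a, b⟩ | ⟨a, b⟩
    · refine Or.inl ⟨lo hk fun j => ?_, hi (up hk) fun j => ?_⟩ <;>
      · have := a j
        have := b j
        simp only [Pi.add_apply, Pi.sub_apply, Pi.one_apply] at *
        omega
    · refine Or.inr ⟨hi hk fun j => ?_, sub_le_iff_le_add.1 (lo (dn hk) fun j => ?_)⟩ <;>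
      · have := a j
        have := b j
        simp only [Pi.add_apply, Pi.sub_apply, Pi.one_apply] at *
        omega
  · rcases h1 with ⟨a, b⟩ | ⟨a, b⟩
    · refine Or.inl ⟨hi hn fun j => ?_, sub_le_iff_le_add.1 (lo (dn hn) fun j => ?_)⟩ <;>
      · have := a j
        have := b j
        simp only [Pi.add_apply, Pi.sub_apply, Pi.one_apply] at *
        omega
    · refine Or.inr ⟨lo hn fun j => ?_, hi (up hn) fun j => ?_⟩ <;>
      · have := a j
        have := b j
        simp only [Pi.add_apply, Pi.sub_apply, Pi.one_apply] at *
        omega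

/-- The growth diagram of a sequence of shapes `T 0, T 1, …`, filled row by row with local rules:
`growth T i k` is the entry `λ^{i,i+k}` in row `i` and column `i + k`. The top row is `T` and the
diagonal entries `λ^{i,i}` are all equal to `λ⁰ = T 0`. -/
def growth {r : ℕ} (T : ℕ → Fin r → ℤ) : ℕ → ℕ → Fin r → ℤ
  | 0, k => T k
  | _ + 1, 0 => T 0
  | i + 1, k + 1 => localRule (growth T i (k + 1)) (growth T i (k + 2)) (growth T (i + 1) k)

theorem growth_diag {r : ℕ} (T : ℕ → Fin r → ℤ) (i : ℕ) : growth T i 0 = T 0 := by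
  cases i <;> simp [growth]

theorem antitone_growth {r : ℕ} {T : ℕ → Fin r → ℤ} (hT : ∀ k, Antitone (T k)) (i k : ℕ) :
    Antitone (growth T i k) := by
  cases i with
  | zero => simpa [growth] using hT k
  | succ i =>
    cases k with
    | zero => simpa [growth] using hT 0
    | succ k => rw [growth]; exact antitone_sortDesc _

/-- Horizontal and vertical neighbours in the growth diagram differ by skew columns. -/
theorem growth_skewColumn {r : ℕ} {T : ℕ → Fin r → ℤ} (hT : ∀ k, Antitone (T k))
    (hs : ∀ k, SkewColumn (T k) (T (k + 1))) (i : ℕ) :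
    (∀ k, SkewColumn (growth T i k) (growth T i (k + 1))) ∧
      (∀ k, SkewColumn (growth T (i + 1) k) (growth T i (k + 1))) := by
  have step : ∀ i, (∀ k, SkewColumn (growth T i k) (growth T i (k + 1))) →
      ∀ k, SkewColumn (growth T (i + 1) k) (growth T i (k + 1)) := by
    intro i hi k
    induction k with
    | zero =>
      have := hi 0
      rw [growth_diag] at this ⊢
      exact this
    | succ k ih =>
      rw [growth]
      exact (localRule_skewColumn (antitone_growth hT _ _) (antitone_growth hT _ _) ih
        (hi (k + 1))).2
  have hor : ∀ i k, SkewColumn (growth T i k) (growth T i (k + 1)) := by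
    intro i
    induction i with
    | zero => simpa [growth] using hs
    | succ i hi =>
      intro k
      rw [growth]
      exact (localRule_skewColumn (antitone_growth hT _ _) (antitone_growth hT _ _) (step i hi k)
        (hi (k + 1))).1
  exact ⟨hor i, step i (hor i)⟩

namespace SkewTableau

/-- The shapes `λ⁰, …, λⁿ` as a sequence indexed by `ℕ`, continued by `λⁿ`. (Promotion and
evacuation below only use the entries `λ^k` with `k ≤ n`.) -/
def shapes {r n : ℕ} (T : SkewTableau r n) (k : ℕ) : Fin r → ℤ :=
  T.shape ⟨min k n, Nat.lt_succ_of_le (min_le_right k n)⟩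

theorem antitone_shapes {r n : ℕ} (T : SkewTableau r n) (k : ℕ) : Antitone (T.shapes k) :=
  T.antitone_shape _

theorem skewColumn_shapes {r n : ℕ} (T : SkewTableau r n) (k : ℕ) :
    SkewColumn (T.shapes k) (T.shapes (k + 1)) := by
  by_cases h : k < n
  · have e1 : T.shapes k = T.shape (Fin.castSucc ⟨k, h⟩) :=
      congrArg T.shape (Fin.ext (by simp; omega))
    have e2 : T.shapes (k + 1) = T.shape (Fin.succ ⟨k, h⟩) :=
      congrArg T.shape (Fin.ext (by simp; omega))
    rw [e1, e2]
    exact T.skewColumn ⟨k, h⟩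
  · have e : T.shapes (k + 1) = T.shapes k :=
      congrArg T.shape (Fin.ext (by simp; omega))
    rw [e]
    exact skewColumn_refl _

/-- Promotion: the row `λ^{11}, …, λ^{1n}, λ^{1,n+1}` of the promotion diagram, where
`λ^{11} = λ⁰`, `λ^{1,n+1} = λⁿ`, and the other entries are given by the local rules. -/
def promotion {r n : ℕ} (T : SkewTableau r n) : SkewTableau r n where
  shape k := if (k : ℕ) < n then growth T.shapes 1 k else T.shape (Fin.last n)
  antitone_shape k := by
    split_ifs
    · exact antitone_growth T.antitone_shapes _ _
    · exact T.antitone_shape _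
  skewColumn k := by
    have h := growth_skewColumn T.antitone_shapes T.skewColumn_shapes
    rw [if_pos (by simp)]
    by_cases hk : (k : ℕ) + 1 < n
    · rw [if_pos (by simpa using hk)]
      exact (h 1).1 k
    · rw [if_neg (by simpa using hk)]
      have e : T.shape (Fin.last n) = growth T.shapes 0 (k + 1) := by
        rw [growth]
        exact congrArg T.shape (Fin.ext (by simp; omega))
      rw [e]
      exact (h 0).2 k

/-- Evacuation: the right column `λ^{nn}, λ^{n-1,n}, …, λ^{0n}` of the evacuation diagram. -/
def evacuation {r n : ℕ} (T : SkewTableau r n) : SkewTableau r n where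
  shape k := growth T.shapes (n - k) k
  antitone_shape k := antitone_growth T.antitone_shapes _ _
  skewColumn k := by
    have h := (growth_skewColumn T.antitone_shapes T.skewColumn_shapes (n - (k + 1))).2 k
    have e : n - (k : ℕ) = n - (k + 1) + 1 := by omega
    simpa [e] using h

/-- The lattice word `w_1 … w_n` of `T`: the letter `w_i` is the (unique) element of `𝒜_r` with
`λ^i = λ^{i-1} + 𝐞_{w_i}`. -/
noncomputable def latticeWord {r n : ℕ} (T : SkewTableau r n) : Fin n → Letter r :=
  fun i => (T.skewColumn i).choose

theorem latticeWord_eq_iff {r n : ℕ} (T : SkewTableau r n) (i : Fin n) (S : Letter r) :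
    T.latticeWord i = S ↔ T.shape i.succ = T.shape i.castSucc + S.vec := by
  have h : T.shape i.succ = T.shape i.castSucc + (T.latticeWord i).vec :=
    (T.skewColumn i).choose_spec
  constructor
  · rintro rfl
    exact h
  · intro hS
    exact Letter.vec_injective (add_left_cancel (h.symm.trans hS))

/-- A rectangular fluctuating tableau: the initial shape is `𝟎` (that is, `T` is not skew) and the
final shape is a generalized rectangle `(c, …, c)`. -/
def IsRectangular {r n : ℕ} (T : SkewTableau r n) : Prop :=
  T.shape 0 = 0 ∧ ∀ a b : Fin r, T.shape (Fin.last n) a = T.shape (Fin.last n) b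

end SkewTableau

/-- The complement `ε` of a letter: replace each element `i` by `sgn(i) (r - |i| + 1)`. -/
def Letter.compl {r : ℕ} (S : Letter r) : Letter r :=
  ⟨S.1.image fun i => i.sign * ((r : ℤ) - |i| + 1), by
    constructor
    · intro x hx
      obtain ⟨i, hi, rfl⟩ := Finset.mem_image.1 hx
      obtain ⟨h1, h2⟩ := S.2.1 i hi
      have h0 : i ≠ 0 := by rintro rfl; simp at h1
      rw [abs_mul, Int.abs_sign_of_ne_zero h0, one_mul, abs_of_nonneg (by omega)]
      omega
    · rcases S.2.2 with hs | hs
      · left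
        intro x hx
        obtain ⟨i, hi, rfl⟩ := Finset.mem_image.1 hx
        have := (S.2.1 i hi).2
        rw [Int.sign_eq_one_of_pos (hs i hi)]
        omega
      · right
        intro x hx
        obtain ⟨i, hi, rfl⟩ := Finset.mem_image.1 hx
        have := (S.2.1 i hi).2
        rw [Int.sign_eq_neg_one_of_neg (hs i hi)]
        omega⟩

/-- The reverse-complement `ε(w_1 … w_n) = ε(w_n) … ε(w_1)` of a word in `𝒜_r`. -/
def reverseComplement {r n : ℕ} (w : Fin n → Letter r) : Fin n → Letter r :=
  fun i => (w i.rev).compl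

end Fluctuating

/-! Both parts rest on one identity: if `λ^n = (c, …, c)`, then the entry `λ^{m,n}` of the growth
diagram is the complement of `λ^m`, that is `c` minus `λ^m` read backwards (`growth_eq_compl`).
Differences of consecutive entries of the last column then give (b). For (a), `m`-fold promotion
reads off row `m` of the diagram, so `𝒫^n` amounts to taking the complement twice.

For the identity, adding multiples of `(1, …, 1)` turns every removed column into an added one and
is compatible with the local rule (`growth_add_const`). The shapes `λ^m, …, λ^n` then form a
transposed semistandard tableau on the rectangle minus `λ^m`. In terms of column heights the local
rule is a jeu de taquin step (`toggle`, `conj_localRule`), and the claim is that rectification has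
the complement of `λ^m` as its shape, whatever the filling (`slides_apply`).

Crystal raising operators move one box from a step to the preceding one, keep the two end shapes,
and commute with slides (`Raise.slide`). Hence the filling may be taken of highest weight. There the
tableau is forced: before rectification each step shifts the column heights by one column, after
rectification step `j` fills column `j` only. Slides preserve the number of boxes of each step, so
the final column heights can be read off (`slides_apply_of_isHighest`). -/

namespace Fluctuating

/-! ### Column heights and the toggle. -/

/-- The conjugates `K`, `L` of two shapes differ by a vertical strip. -/
def Strip (K L : ℤ → ℤ) : Prop := ∀ v, K v ≤ L v ∧ L (v + 1) ≤ K v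

theorem Strip.le {K L : ℤ → ℤ} (h : Strip K L) (v : ℤ) : K v ≤ L v := (h v).1

theorem Strip.succ_le {K L : ℤ → ℤ} (h : Strip K L) (v : ℤ) : L (v + 1) ≤ K v := (h v).2

theorem Strip.le_pred {K L : ℤ → ℤ} (h : Strip K L) (v : ℤ) : L v ≤ K (v - 1) := by
  simpa using (h (v - 1)).2

theorem Strip.antitone_left {K L : ℤ → ℤ} (h : Strip K L) : Antitone K :=
  antitone_int_of_succ_le fun v => (h.le _).trans (h.succ_le v)

/-- The local rule in terms of conjugate shapes. -/
def toggle (K L N : ℤ → ℤ) : ℤ → ℤ := fun v =>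
  min (N v) (K (v - 1)) + max (N (v + 1)) (K v) - L v

theorem Strip.toggle_left {K L N : ℤ → ℤ} (h : Strip K L) (h' : Strip L N) :
    Strip K (toggle K L N) := by
  intro v
  have := h.le v; have := h.le_pred v; have := h'.le v
  have := h.le (v + 1); have := h.succ_le v; have := h'.le_pred (v + 1); have := h'.succ_le (v + 1)
  have := h.succ_le (v + 1)
  simp only [toggle, add_sub_cancel_right] at *
  omega

theorem Strip.toggle_right {K L N : ℤ → ℤ} (h : Strip K L) (h' : Strip L N) :
    Strip (toggle K L N) N := by
  intro v
  have := h.le v; have := h.le_pred v; have := h'.le v; have := h'.succ_le v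
  have := h.succ_le v
  simp only [toggle] at *
  omega

/-- The shape fits into `r` rows and `C` columns. -/
def Fits (r C : ℤ) (K : ℤ → ℤ) : Prop := (∀ v ≤ 0, K v = r) ∧ ∀ v, C < v → K v = 0

theorem Fits.toggle {r C : ℤ} {K L N : ℤ → ℤ} (hK : Fits r C K) (hN : Fits r C N)
    (h : Strip K L) (h' : Strip L N) : Fits r C (toggle K L N) := by
  constructor <;> intro v hv
  · have := (h.toggle_left h').le v; have := (h.toggle_right h').le v
    have := hK.1 v hv; have := hN.1 v hv
    omega
  · have := (h.toggle_left h').le v; have := (h.toggle_right h').le v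
    have := hK.2 v hv; have := hN.2 v hv
    omega

/-! ### Raising operators and their commutation with slides. -/

/-- The heights of the signature word of the two steps `K → L → N`. -/
def IsPotential (K L N D : ℤ → ℤ) : Prop :=
  ∀ v, D v - D (v + 1) = N (v + 1) - L (v + 1) - (L v - K v)

/-- The potential of the two steps obtained by sliding `K → L → N` to start at `T`. -/
def slidePotential (T K L N D : ℤ → ℤ) : ℤ → ℤ := fun v =>
  D v + (L v - min (L v) (T (v - 1))) - (N (v + 1) - min (N (v + 1)) (toggle T K L v))

/-- Up to a constant, `D v` is the number of second-step boxes in columns `> v` minus the number of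
first-step boxes in columns `≥ v`. The two corrections in `slidePotential` count the boxes of each
step that cross the corresponding column boundary during the slide. -/
theorem IsPotential.slide {T K L N D : ℤ → ℤ} (hD : IsPotential K L N D) :
    IsPotential T (toggle T K L) (toggle (toggle T K L) L N) (slidePotential T K L N D) := by
  intro v
  have h1 := hD v
  have hM : toggle T K L v = min (L v) (T (v - 1)) + max (L (v + 1)) (T v) - K v := rfl
  simp only [slidePotential]
  rw [show toggle (toggle T K L) L N (v + 1) = min (N (v + 1)) (toggle T K L v)
    + max (N (v + 1 + 1)) (toggle T K L (v + 1)) - L (v + 1) by simp [toggle]]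
  simp only [add_sub_cancel_right]
  omega

/-- The potential after sliding is bounded below by the neighbouring ones. -/
theorem le_slidePotential {T K L N D : ℤ → ℤ} (hD : IsPotential K L N D) (v : ℤ) :
    D v ≤ slidePotential T K L N D v ∨
      D (v + 1) + (max (L (v + 1)) (T v) - L (v + 1)) = slidePotential T K L N D v := by
  -- The alternatives correspond to `N (v + 1) ≤ toggle T K L v`, when no second-step box leaves
  -- column `v + 1`, and its negation.
  have h1 := hD v
  have hM : toggle T K L v = min (L v) (T (v - 1)) + max (L (v + 1)) (T v) - K v := rfl
  simp only [slidePotential]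
  omega

/-- `L'` is obtained from the two steps `K → L → N` by the raising operator. -/
def Raise (K L L' N : ℤ → ℤ) : Prop :=
  ∃ D x, IsPotential K L N D ∧ (∀ v, x < v → D x ≤ D v) ∧ (∀ v < x, D x < D v) ∧
    L' = Function.update L x (L x + 1)

/-- The raised box sits in the column of the leftmost minimum of the potential. Sliding either
leaves it in column `x` or carries it to column `x - 1`, and the leftmost minimum of the slid
potential moves in the same way. -/
theorem Raise.slide {T K L L' N : ℤ → ℤ} (hK : Strip K L)
    (hR : Raise K L L' N) :
    Raise T (toggle T K L) (toggle T K L') (toggle (toggle T K L) L N) ∧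
      toggle (toggle T K L') L' N = toggle (toggle T K L) L N := by
  obtain ⟨D, x, hD, hge, hlt, rfl⟩ := hR
  set L' := Function.update L x (L x + 1) with hL'
  have eL : L' x = L x + 1 := by simp [L']
  have nL : ∀ v, v ≠ x → L' v = L v := fun v hv => by simp [L', hv]
  have key := le_slidePotential (T := T) hD
  by_cases hx : L x < T (x - 1)
  · -- the raised entry keeps its column
    have hM' : toggle T K L' = Function.update (toggle T K L) x (toggle T K L x + 1) := by
      funext v
      rcases eq_or_ne v x with rfl | hv
      · rw [Function.update_self]
        simp only [toggle, eL, nL (v + 1) (by omega)]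
        omega
      · rw [Function.update_of_ne hv]
        simp only [toggle, nL v hv]
        rcases eq_or_ne (v + 1) x with h | h
        · rw [h, eL]
          have : T v = T (x - 1) := by rw [← h]; simp
          omega
        · rw [nL _ h]
    -- From `D x ≤ D (x + 1)`: no second-step box crosses from column `x + 1` to `x`, so the
    -- potential at `x` is unchanged.
    have hN : N (x + 1) ≤ toggle T K L x := by
      have := hD x
      have := hge (x + 1) (by omega)
      simp only [toggle]
      omega
    have hDx : slidePotential T K L N D x = D x := by
      simp only [slidePotential]
      omega
    refine ⟨⟨slidePotential T K L N D, x, hD.slide, fun v hv => ?_, fun v hv => ?_, hM'⟩, ?_⟩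
    · have := hge v hv
      have := hge (v + 1) (by omega)
      have := key v
      omega
    · have := hlt v hv
      have := key v
      -- Only at `v = x - 1` could the slid potential drop to `D x`; the excess of `T (x - 1)` over
      -- `L x` keeps the inequality strict.
      rcases eq_or_ne (v + 1) x with h | h
      · have : T v = T (x - 1) := by rw [← h]; simp
        have h1 := key v
        rw [h] at h1
        omega
      · have := hlt (v + 1) (by omega)
        omega
    · rw [hM']
      funext v
      simp only [toggle.eq_def (Function.update _ _ _), toggle.eq_def (toggle T K L)]
      rcases eq_or_ne v x with rfl | hv
      · rw [Function.update_self, Function.update_of_ne (by omega), eL]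
        omega
      · rw [Function.update_of_ne hv, nL v hv]
        rcases eq_or_ne (v - 1) x with h | h
        · rw [h, Function.update_self]
          have : N v = N (x + 1) := by rw [← h]; simp
          omega
        · rw [Function.update_of_ne h]
  · -- the raised entry moves to the previous column
    have hM' : toggle T K L' =
        Function.update (toggle T K L) (x - 1) (toggle T K L (x - 1) + 1) := by
      funext v
      rcases eq_or_ne v (x - 1) with rfl | hv
      · rw [Function.update_self]
        simp only [toggle, sub_add_cancel, eL, nL (x - 1) (by omega)]
        omega
      · rw [Function.update_of_ne hv]
        simp only [toggle, nL (v + 1) (by omega)]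
        rcases eq_or_ne v x with rfl | h
        · rw [eL]
          omega
        · rw [nL _ h]
    have hd := hD (x - 1)
    have hl := hlt (x - 1) (by omega)
    have hpos := hK.le (x - 1)
    rw [sub_add_cancel] at hd
    have hMx : toggle T K L (x - 1) = min (L (x - 1)) (T (x - 1 - 1)) + L x - K (x - 1) := by
      simp only [toggle, sub_add_cancel]
      omega
    -- From `D x < D (x - 1)`: the value `D x` is now attained by the slid potential at `x - 1`.
    have hN : toggle T K L (x - 1) < N x := by omega
    have hDx : slidePotential T K L N D (x - 1) = D x := by
      simp only [slidePotential, sub_add_cancel]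
      omega
    refine ⟨⟨slidePotential T K L N D, x - 1, hD.slide, fun v hv => ?_, fun v hv => ?_, hM'⟩, ?_⟩
    · have h1 : D x ≤ D v := by
        rcases eq_or_ne v x with rfl | h
        · exact le_rfl
        · exact hge v (by omega)
      have := hge (v + 1) (by omega)
      have := key v
      omega
    · have := hlt v (by omega)
      have := hlt (v + 1) (by omega)
      have := key v
      omega
    · rw [hM']
      funext v
      simp only [toggle.eq_def (Function.update _ _ _), toggle.eq_def (toggle T K L)]
      rcases eq_or_ne v x with rfl | hv
      · rw [Function.update_self, Function.update_of_ne (by omega), eL]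
        omega
      · rw [nL v hv, Function.update_of_ne (a := v - 1) (by omega)]
        rcases eq_or_ne v (x - 1) with rfl | h
        · rw [Function.update_self, sub_add_cancel]
          omega
        · rw [Function.update_of_ne h]

/-- The strict drop `D x < D (x - 1)` gives `L x < N x` and `L x < K (x - 1)`, which is exactly the
room needed for the new box. -/
theorem Raise.strip {K L L' N : ℤ → ℤ} (hK : Strip K L) (hN : Strip L N) (hR : Raise K L L' N) :
    Strip K L' ∧ Strip L' N := by
  obtain ⟨D, x, hD, -, hlt, rfl⟩ := hR
  have hd := hD (x - 1)
  have hl := hlt (x - 1) (by omega)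
  rw [sub_add_cancel] at hd
  have h1 := hK.le (x - 1)
  have h2 := hN.le_pred x
  constructor <;> intro v
  · have := hK v
    rcases eq_or_ne v x with rfl | h
    · rw [Function.update_self, Function.update_of_ne (by omega)]
      omega
    · rw [Function.update_of_ne h]
      rcases eq_or_ne (v + 1) x with h' | h'
      · obtain rfl : v = x - 1 := by omega
        rw [h', Function.update_self]
        omega
      · rw [Function.update_of_ne h']
        exact this
  · have := hN v
    rcases eq_or_ne v x with rfl | h
    · rw [Function.update_self]
      omega
    · rw [Function.update_of_ne h]
      exact this

/-- The two steps `K → L → N` form a highest weight element. -/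
def IsHighest (K L N : ℤ → ℤ) : Prop := ∃ D, IsPotential K L N D ∧ ∀ v, D 0 ≤ D v

theorem IsHighest.slide {r C : ℤ} {T K L N : ℤ → ℤ} (hT : Fits r C T) (hL : Fits r C L)
    (hTK : Strip T K) (hKL : Strip K L) (hLN : Strip L N)
    (h : IsHighest K L N) :
    IsHighest T (toggle T K L) (toggle (toggle T K L) L N) := by
  obtain ⟨D, hD, h0⟩ := h
  refine ⟨_, hD.slide, fun v => ?_⟩
  -- Columns `≤ 0` are full, so no box crosses out of column `0`, or out of column `1` into column
  -- `0`.
  have e : slidePotential T K L N D 0 = D 0 := by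
    have h1 : toggle T K L 0 = r := (hT.toggle hL hTK hKL).1 0 le_rfl
    have h2 := hL.1 0 le_rfl
    have h3 := hT.1 (0 - 1) (by omega)
    have h4 := hLN.succ_le 0
    simp only [slidePotential]
    omega
  have := le_slidePotential (T := T) hD v
  have := h0 v
  have := h0 (v + 1)
  omega

/-- The potential is constant on `v ≤ 0` and on `v > C`, so it has a minimum. Failure of highest
weight puts the leftmost minimum to the right of `0`, and it cannot lie beyond `C` because there are
no second-step boxes there. -/
theorem exists_raise {r C : ℤ} {K L N : ℤ → ℤ} (hK : Fits r C K) (hL : Fits r C L)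
    (hN : Fits r C N) (hKL : Strip K L) (h : ¬ IsHighest K L N) :
    ∃ L', Raise K L L' N ∧ Fits r C L' ∧ ∃ x, 0 < x ∧ x ≤ C ∧
      L' = Function.update L x (L x + 1) := by
  set d : ℤ → ℤ := fun v => N (v + 1) - L (v + 1) - (L v - K v) with hd
  have d_top : ∀ v, C < v → d v = 0 := fun v hv => by
    have := hK.2 v hv; have := hL.2 v hv
    have := hN.2 (v + 1) (by omega); have := hL.2 (v + 1) (by omega)
    simp only [d]; omega
  have d_bot : ∀ v < 0, d v = 0 := fun v hv => by
    have := hK.1 v hv.le; have := hL.1 v hv.le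
    have := hN.1 (v + 1) (by omega); have := hL.1 (v + 1) (by omega)
    simp only [d]; omega
  set D : ℤ → ℤ := fun v => ∑ w ∈ Finset.Ico v (C + 1), d w with hDdef
  have hD : ∀ v, D v - D (v + 1) = d v := by
    intro v
    by_cases hv : C < v
    · simp only [D]
      rw [Finset.Ico_eq_empty (by omega), Finset.Ico_eq_empty (by omega), d_top v hv]
      simp
    · simp only [D]
      rw [← Finset.insert_Ico_add_one_left_eq_Ico (by omega : v < C + 1),
        Finset.sum_insert (by simp)]
      simp
  have D_top : ∀ v, C < v → D v = 0 := fun v hv => by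
    simp only [D]; rw [Finset.Ico_eq_empty (by omega)]; simp
  have D_bot : ∀ k : ℕ, D (-k) = D 0 := by
    intro k
    induction k with
    | zero => simp
    | succ k ih =>
      have := hD (-(k + 1 : ℕ))
      rw [d_bot _ (by push_cast; omega)] at this
      rw [show -((k + 1 : ℕ) : ℤ) + 1 = -k by push_cast; ring] at this
      omega
  have D_neg : ∀ v ≤ 0, D v = D 0 := fun v hv => by
    have := D_bot v.natAbs
    rwa [show -(v.natAbs : ℤ) = v by omega] at this
  obtain ⟨y, hy⟩ : ∃ y, D y < D 0 := by
    by_contra! hcon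
    exact h ⟨D, hD, hcon⟩
  obtain ⟨z, hz, hzmin⟩ := Finset.exists_min_image (Finset.Icc 0 (max 0 (C + 1))) D ⟨0, by simp⟩
  have zmin : ∀ v, D z ≤ D v := by
    intro v
    rcases lt_or_ge v 0 with hv | hv
    · rw [D_neg v hv.le]; exact hzmin 0 (by simp)
    · rcases lt_or_ge C v with hv' | hv'
      · rw [D_top v hv', ← D_top (max 0 (C + 1)) (by omega)]
        exact hzmin _ (by simp)
      · exact hzmin v (by simp; omega)
  obtain ⟨x, ⟨hx0, hx⟩, hxmin⟩ : ∃ x : ℤ, (0 ≤ x ∧ D x = D z) ∧ ∀ v, (0 ≤ v ∧ D v = D z) → x ≤ v :=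
    Int.exists_least_of_bdd ⟨0, fun v hv => hv.1⟩ ⟨z, by simp at hz; omega, rfl⟩
  have hlt : ∀ v < x, D x < D v := by
    intro v hv
    have h1 := zmin v
    rcases lt_or_ge v 0 with hv0 | hv0
    · have := D_neg v hv0.le; have := zmin y; omega
    · by_contra hcon
      have := hxmin v ⟨hv0, by omega⟩
      omega
  have hxpos : 0 < x := by
    rcases hx0.eq_or_lt with h0 | h0
    · have := zmin y
      rw [← h0] at hx
      omega
    · exact h0
  have hxC : x ≤ C := by
    by_contra hcon
    have h1 := hlt (x - 1) (by omega)
    have h2 := hD (x - 1)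
    rw [sub_add_cancel] at h2
    have h3 : d (x - 1) ≤ 0 := by
      have := hN.2 x (by omega); have := hL.2 x (by omega); have := hKL.le (x - 1)
      simp only [d, sub_add_cancel]; omega
    omega
  refine ⟨_, ⟨D, x, hD, fun v _ => hx ▸ zmin v, hlt, rfl⟩, ⟨fun v hv => ?_, fun v hv => ?_⟩,
    x, hxpos, hxC, rfl⟩
  · rw [Function.update_of_ne (by omega)]; exact hL.1 v hv
  · rw [Function.update_of_ne (by omega)]; exact hL.2 v hv

/-! ### Sliding whole paths. -/

/-- The path obtained by sliding the path `U` to start at `t`. -/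
def slidePath (t : ℤ → ℤ) (U : ℕ → ℤ → ℤ) : ℕ → ℤ → ℤ
  | 0 => t
  | k + 1 => toggle (slidePath t U k) (U k) (U (k + 1))

/-- The paths obtained by sliding `U` successively to start at `t 1`, `t 2`, …. -/
def slides (t : ℕ → ℤ → ℤ) (U : ℕ → ℤ → ℤ) : ℕ → ℕ → ℤ → ℤ
  | 0 => U
  | i + 1 => slidePath (t (i + 1)) (slides t U i)

/-- A path of conjugate shapes, each inside the rectangle with `r` rows and `C` columns, and each
adding a vertical strip to the one before. -/
structure IsPath (r C : ℤ) (U : ℕ → ℤ → ℤ) : Prop where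
  fits : ∀ k, Fits r C (U k)
  strip : ∀ k, Strip (U k) (U (k + 1))

theorem IsPath.strip_slidePath {r C : ℤ} {t : ℤ → ℤ} {U : ℕ → ℤ → ℤ} (hU : IsPath r C U)
    (ht : Strip t (U 0)) (k : ℕ) : Strip (slidePath t U k) (U k) := by
  induction k with
  | zero => exact ht
  | succ k ih => exact ih.toggle_right (hU.strip k)

theorem IsPath.slide {r C : ℤ} {t : ℤ → ℤ} {U : ℕ → ℤ → ℤ} (hU : IsPath r C U)
    (ht : Strip t (U 0)) (ht' : Fits r C t) : IsPath r C (slidePath t U) where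
  fits k := by
    induction k with
    | zero => exact ht'
    | succ k ih => exact ih.toggle (hU.fits _) (hU.strip_slidePath ht k) (hU.strip k)
  strip k := (hU.strip_slidePath ht k).toggle_left (hU.strip k)

/-- A chain of conjugate shapes, each removing a vertical strip from the one before. -/
structure IsChain (r C : ℤ) (t : ℕ → ℤ → ℤ) : Prop where
  fits : ∀ k, Fits r C (t k)
  strip : ∀ k, Strip (t (k + 1)) (t k)

theorem slides_zero {t : ℕ → ℤ → ℤ} {U : ℕ → ℤ → ℤ} (h : U 0 = t 0) (i : ℕ) :
    slides t U i 0 = t i := by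
  cases i with
  | zero => exact h
  | succ i => rfl

theorem slides_succ (t U : ℕ → ℤ → ℤ) (i k : ℕ) : slides t U (i + 1) (k + 1) =
    toggle (slides t U (i + 1) k) (slides t U i k) (slides t U i (k + 1)) := rfl

theorem IsPath.slide_iter {r C : ℤ} {t : ℕ → ℤ → ℤ} {U : ℕ → ℤ → ℤ} (hU : IsPath r C U)
    (ht : IsChain r C t) (h : U 0 = t 0) (i : ℕ) : IsPath r C (slides t U i) := by
  induction i with
  | zero => exact hU
  | succ i ih => exact ih.slide (slides_zero h i ▸ ht.strip i) (ht.fits _)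

/-- `U'` is obtained from `U` by raising the shape with index `j + 1`. -/
structure Move (j : ℕ) (U U' : ℕ → ℤ → ℤ) : Prop where
  eq : ∀ k, k ≠ j + 1 → U' k = U k
  raise : Raise (U j) (U (j + 1)) (U' (j + 1)) (U (j + 2))

/-- By `Raise.slide` the slid paths agree again at index `j + 2`, so the change stays confined to
index `j + 1`. -/
theorem Move.slide {r C : ℤ} {t : ℤ → ℤ} {U U' : ℕ → ℤ → ℤ} {j : ℕ} (hU : IsPath r C U)
    (hm : Move j U U') : Move j (slidePath t U) (slidePath t U') := by
  have below : ∀ k ≤ j, slidePath t U' k = slidePath t U k := by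
    intro k hk
    induction k with
    | zero => rfl
    | succ k ih =>
      rw [slidePath, slidePath, ih (by omega), hm.eq _ (by omega),
        hm.eq _ (by omega)]
  have hj : slidePath t U' (j + 1) = toggle (slidePath t U j) (U j) (U' (j + 1)) := by
    rw [slidePath, below j le_rfl, hm.eq j (by omega)]
  obtain ⟨h1, h2⟩ := hm.raise.slide (T := slidePath t U j) (hU.strip j)
  have hj2 : slidePath t U' (j + 2) = slidePath t U (j + 2) := by
    rw [slidePath, hj, hm.eq (j + 2) (by omega), h2]
    rfl
  refine ⟨fun k hk => ?_, ?_⟩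
  · rcases lt_or_ge j k with h | h
    · obtain ⟨l, rfl⟩ := Nat.exists_eq_add_of_le (show j + 2 ≤ k by omega)
      clear h hk
      induction l with
      | zero => exact hj2
      | succ l ih =>
        rw [← add_assoc, slidePath, slidePath, ih, hm.eq _ (by omega),
          hm.eq _ (by omega)]
    · exact below k h
  · rw [hj]
    exact h1

theorem Move.slide_iter {r C : ℤ} {t : ℕ → ℤ → ℤ} {U U' : ℕ → ℤ → ℤ} {j : ℕ} (hU : IsPath r C U)
    (ht : IsChain r C t) (h : U 0 = t 0) (hm : Move j U U') (i : ℕ) :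
    Move j (slides t U i) (slides t U' i) := by
  induction i with
  | zero => exact hm
  | succ i ih => exact ih.slide (hU.slide_iter ht h i)

theorem isHighest_slides {r C : ℤ} {t : ℕ → ℤ → ℤ} {U : ℕ → ℤ → ℤ} {j : ℕ} (hU : IsPath r C U)
    (ht : IsChain r C t) (h : U 0 = t 0) (hj : IsHighest (U j) (U (j + 1)) (U (j + 2))) (i : ℕ) :
    IsHighest (slides t U i j) (slides t U i (j + 1)) (slides t U i (j + 2)) := by
  induction i with
  | zero => exact hj
  | succ i ih =>
    have hp := hU.slide_iter ht h i
    have hs : Strip (t (i + 1)) (slides t U i 0) := slides_zero h i ▸ ht.strip i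
    exact ih.slide ((hp.slide hs (ht.fits _)).fits j) (hp.fits _)
      (hp.strip_slidePath hs j) (hp.strip j) (hp.strip _)

/-- The vertical strip from `K` to `L` has `s` boxes, all of them in the first `C` columns. -/
def HasSize (C : ℤ) (K L : ℤ → ℤ) (s : ℤ) : Prop :=
  ∃ A : ℤ → ℤ, (∀ v, A v - A (v + 1) = L v - K v) ∧ (∀ v, C < v → A v = 0) ∧ A 0 = s

theorem HasSize.slide {r C s : ℤ} {T K L : ℤ → ℤ} (hT : Fits r C T) (hK : Fits r C K)
    (hL : Fits r C L) (hTK : Strip T K) (h : HasSize C K L s) :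
    HasSize C T (toggle T K L) s := by
  obtain ⟨A, hA, htop, h0⟩ := h
  -- `A v` counts the boxes in columns `≥ v`; of these, `L v - min (L v) (T (v - 1))` slide into
  -- column `v - 1`.
  refine ⟨fun v => A v + min (L v) (T (v - 1)) - L v, fun v => ?_, fun v hv => ?_, ?_⟩
  · have := hA v
    simp only [toggle, add_sub_cancel_right]
    omega
  · have h1 := htop v hv
    have h2 := hL.2 v hv
    have h3 := hTK.le_pred v
    have h4 := hK.2 v hv
    simp only
    omega
  · have h2 := hL.1 0 le_rfl
    have h3 := hT.1 (0 - 1) (by omega)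
    simp only
    omega

theorem hasSize_slides {r C s : ℤ} {t : ℕ → ℤ → ℤ} {U : ℕ → ℤ → ℤ} {j : ℕ} (hU : IsPath r C U)
    (ht : IsChain r C t) (h : U 0 = t 0) (hj : HasSize C (U j) (U (j + 1)) s) (i : ℕ) :
    HasSize C (slides t U i j) (slides t U i (j + 1)) s := by
  induction i with
  | zero => exact hj
  | succ i ih =>
    have hp := hU.slide_iter ht h i
    have hs : Strip (t (i + 1)) (slides t U i 0) := slides_zero h i ▸ ht.strip i
    exact ih.slide ((hp.slide hs (ht.fits _)).fits j) (hp.fits _) (hp.fits _)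
      (hp.strip_slidePath hs j)

/-! ### Highest weight paths and the shape of the rectification. -/

theorem eq_succ_of_le_of_le {D : ℤ → ℤ} {c : ℤ} (h : ∀ v, 0 ≤ v → v < c → D (v + 1) ≤ D v)
    (h0 : D 0 ≤ D c) {v : ℤ} (hv : 0 ≤ v) (hvc : v < c) : D v = D (v + 1) := by
  have mono : ∀ a, 0 ≤ a → ∀ b, a ≤ b → b ≤ c → D b ≤ D a := by
    intro a ha b hab
    induction b, hab using Int.leInduction with
    | base => intro _; exact le_rfl
    | succ n hn ih => intro hc; exact (h n (by omega) (by omega)).trans (ih (by omega))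
  have := mono 0 le_rfl v hv (by omega)
  have := mono (v + 1) (by omega) c (by omega) le_rfl
  have := h v hv hvc
  omega

/-- A highest weight path ending at the rectangle is determined by its first shape. -/
theorem IsPath.eq_of_isHighest_of_rectangle {r C : ℤ} {U : ℕ → ℤ → ℤ} {p : ℕ}
    (hU : IsPath r C U) (hp : ∀ v ≤ C, U p v = r)
    (hh : ∀ j, j + 2 ≤ p → IsHighest (U j) (U (j + 1)) (U (j + 2)))
    {j : ℕ} (hj : j < p) {v : ℤ} (hv : v < C) : U j v = U (j + 1) (v + 1) := by
  obtain ⟨q, hq⟩ := Nat.exists_eq_add_of_le (Nat.succ_le_of_lt hj)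
  clear hj
  induction q generalizing j v with
  | zero =>
    obtain rfl : p = j + 1 := hq
    have h1 := (hU.strip j).succ_le v
    rw [hp _ (by omega)] at h1 ⊢
    rcases le_or_gt v 0 with h | h
    · exact (hU.fits j).1 v h
    · have := (hU.strip j).antitone_left h.le
      have := (hU.fits j).1 0 le_rfl
      omega
  | succ q ih =>
    have ih' : ∀ v, v < C → U (j + 1) v = U (j + 1 + 1) (v + 1) := fun v hv =>
      ih hv (by omega)
    rcases lt_or_ge v 0 with h | h
    · rw [(hU.fits _).1 v h.le, (hU.fits _).1 _ (by omega)]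
    · obtain ⟨D, hD, h0⟩ : IsHighest (U j) (U (j + 1)) (U (j + 1 + 1)) := hh j (by omega)
      -- By induction `D v - D (v + 1) = U j v - U (j + 1) (v + 1) ≥ 0`, so `D 0 ≤ D C` forces
      -- equality throughout.
      have := eq_succ_of_le_of_le (D := D) (c := C) (fun v _ hvC => by
        have := hD v; have := ih' v hvC; have := (hU.strip j).succ_le v
        omega) (h0 C) h hv
      have := hD v; have := ih' v hv
      omega

theorem IsPath.eq_zero_of_lt {r C : ℤ} {V : ℕ → ℤ → ℤ} (hV : IsPath r C V)
    (h0 : ∀ v, 0 < v → V 0 v = 0) (j : ℕ) {v : ℤ} (hv : (j : ℤ) < v) : V j v = 0 := by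
  induction j generalizing v with
  | zero => exact h0 v (by simpa using hv)
  | succ j ih =>
    have h1 := (hV.strip j).le v
    have h2 := (hV.strip j).le_pred v
    push_cast at hv
    rw [ih (by omega)] at h1 h2
    omega

/-- In a highest weight path each step `j → j + 1` leaves the columns up to `j` unchanged. -/
theorem IsPath.eq_of_isHighest_of_le {r C : ℤ} {V : ℕ → ℤ → ℤ} {p : ℕ} (hV : IsPath r C V)
    (hh : ∀ j, j + 2 ≤ p → IsHighest (V j) (V (j + 1)) (V (j + 2)))
    {j : ℕ} (hj : j < p) {v : ℤ} (hv : v ≤ j) : V j v = V (j + 1) v := by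
  induction j generalizing v with
  | zero =>
    push_cast at hv
    rw [(hV.fits _).1 v hv, (hV.fits _).1 v hv]
  | succ j ih =>
    push_cast at hv
    rcases le_or_gt v 0 with h | h
    · rw [(hV.fits _).1 v h, (hV.fits _).1 v h]
    · obtain ⟨D, hD, hD0⟩ : IsHighest (V j) (V (j + 1)) (V (j + 1 + 1)) := hh j (by omega)
      -- By induction the first step adds nothing in columns `≤ j`, so `D` decreases weakly up to `j
      -- + 1`; with `D 0 ≤ D (j + 1)` the second step adds nothing in columns `1, …, j + 1`.
      have := eq_succ_of_le_of_le (D := D) (c := j + 1) (fun v _ hvC => by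
        have := hD v; have := ih (by omega) (v := v) (by omega)
        have := (hV.strip (j + 1)).le (v + 1)
        omega) (hD0 _) (v := v - 1) (by omega) (by omega)
      have h1 := hD (v - 1)
      have := ih (by omega) (v := v - 1) (by omega)
      rw [sub_add_cancel] at *
      omega

/-- After rectification, column `j + 1` consists precisely of the boxes of the step from index `j`
to `j + 1`. Their number is invariant under slides and is computed in `U`. -/
theorem slides_apply_of_isHighest {r C : ℤ} {t : ℕ → ℤ → ℤ} {U : ℕ → ℤ → ℤ} {m p : ℕ}
    (hC : 0 ≤ C) (hU : IsPath r C U) (ht : IsChain r C t) (h : U 0 = t 0)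
    (hp : ∀ v ≤ C, U p v = r) (hm : ∀ v, 0 < v → t m v = 0)
    (hh : ∀ j, j + 2 ≤ p → IsHighest (U j) (U (j + 1)) (U (j + 2))) (v : ℤ) :
    slides t U m p v = r - U 0 (C + 1 - v) := by
  have hV := hU.slide_iter ht h m
  have hV0 : ∀ v, 0 < v → slides t U m 0 v = 0 := fun v hv => by
    rw [slides_zero h]; exact hm v hv
  have hVh : ∀ j, j + 2 ≤ p → IsHighest (slides t U m j) (slides t U m (j + 1))
      (slides t U m (j + 2)) := fun j hj => isHighest_slides hU ht h (hh j hj) m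
  have diag : ∀ j : ℕ, j ≤ p → ∀ v : ℤ, v + j ≤ C → U 0 v = U j (v + j) := by
    intro j hj
    induction j with
    | zero => simp
    | succ j ih =>
      intro v hv
      push_cast at hv ⊢
      rw [ih (by omega) v (by omega),
        hU.eq_of_isHighest_of_rectangle hp hh (by omega) (by omega), add_assoc]
  rcases le_or_gt v 0 with hv | hv
  · rw [(hV.fits p).1 v hv, (hU.fits 0).2 _ (by omega), sub_zero]
  rcases lt_or_ge (p : ℤ) v with hvp | hvp
  · rw [hV.eq_zero_of_lt hV0 p hvp, diag p le_rfl _ (by omega), hp _ (by omega), sub_self]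
  obtain ⟨j, rfl⟩ : ∃ j : ℕ, v = j + 1 := ⟨(v - 1).toNat, by omega⟩
  have hjp : j < p := by omega
  have col : ∀ q, j + 1 ≤ q → q ≤ p →
      slides t U m q (j + 1) = slides t U m (j + 1) (j + 1) := by
    intro q hq
    induction q, hq using Nat.le_induction with
    | base => intro _; rfl
    | succ q hq ih =>
      intro hqp
      rw [← ih (by omega)]
      exact (hV.eq_of_isHighest_of_le hVh (by omega) (by omega)).symm
  rw [col p (by omega) le_rfl]
  have hsize : HasSize C (U j) (U (j + 1)) (r - U 0 (C - j)) := by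
    -- Since `U j w = U (j + 1) (w + 1)` for `w < C`, the tail sums of the step telescope.
    refine ⟨fun w => if w ≤ C then U (j + 1) w - U j C else 0, fun w => ?_, fun w hw => ?_, ?_⟩
    · dsimp only
      rcases lt_trichotomy w C with hw | rfl | hw
      · rw [if_pos hw.le, if_pos (by omega),
          hU.eq_of_isHighest_of_rectangle hp hh hjp hw]
        ring
      · rw [if_pos le_rfl, if_neg (by omega), sub_zero]
      · rw [if_neg (by omega), if_neg (by omega), (hU.fits _).2 _ hw, (hU.fits _).2 _ hw]
    · exact if_neg (by omega)
    · dsimp only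
      rw [if_pos hC, (hU.fits _).1 0 le_rfl, diag j hjp.le _ (by omega), sub_add_cancel]
  obtain ⟨A, hA, htop, hA0⟩ := hasSize_slides hU ht h hsize m
  have hAj : A (j + 1) = A (j + 1 + 1) + slides t U m (j + 1) (j + 1) := by
    have := hA (j + 1)
    rw [hV.eq_zero_of_lt hV0 j (by omega)] at this
    omega
  -- The tail counts are constant on both sides of column `j + 1`, so all boxes of this step lie in
  -- that column.
  have hAbot : ∀ k : ℕ, k ≤ j + 1 → A k = A 0 := by
    intro k hk
    induction k with
    | zero => simp
    | succ k ih =>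
      have h1 := hA k
      rw [← hV.eq_of_isHighest_of_le hVh hjp (v := k) (by omega)] at h1
      push_cast
      rw [← ih (by omega)]
      omega
  have hAtop : ∀ k : ℕ, A (j + 1 + 1 + k) = A (j + 1 + 1) := by
    intro k
    induction k with
    | zero => simp
    | succ k ih =>
      have h1 := hA (j + 1 + 1 + k)
      rw [hV.eq_zero_of_lt hV0 j (by omega), hV.eq_zero_of_lt hV0 (j + 1) (by push_cast; omega)]
        at h1
      push_cast
      rw [← ih, ← add_assoc]
      omega
  have h1 := hAbot (j + 1) le_rfl
  have h2 := hAtop (C.toNat + 1)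
  rw [htop _ (by omega)] at h2
  push_cast at h1
  rw [show C + 1 - ((j : ℤ) + 1) = C - j by ring]
  omega

/-- Sliding a path from `t 0` to the rectangle until it starts at the empty shape, the final shape
is the complement of `t 0` in the rectangle. -/
theorem slides_apply {r C : ℤ} {t : ℕ → ℤ → ℤ} {m p : ℕ} (hC : 0 ≤ C) (ht : IsChain r C t)
    (hm : ∀ v, 0 < v → t m v = 0) (U : ℕ → ℤ → ℤ) (hU : IsPath r C U) (h : U 0 = t 0)
    (hp : ∀ v ≤ C, U p v = r) (v : ℤ) :
    slides t U m p v = r - U 0 (C + 1 - v) := by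
  by_cases hh : ∀ j, j + 2 ≤ p → IsHighest (U j) (U (j + 1)) (U (j + 2))
  · exact slides_apply_of_isHighest hC hU ht h hp hm hh v
  push Not at hh
  obtain ⟨j, hj, hh⟩ := hh
  obtain ⟨L', hR, hF, x, hx0, hxC, hL'⟩ :=
    exists_raise (hU.fits j) (hU.fits (j + 1)) (hU.fits (j + 2)) (hU.strip j) hh
  set U' := Function.update U (j + 1) L' with hU'
  have e1 : U' (j + 1) = L' := by simp [U']
  have e2 : ∀ k, k ≠ j + 1 → U' k = U k := fun k hk => by simp [U', hk]
  have hst := hR.strip (hU.strip j) (hU.strip (j + 1))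
  have hmove : Move j U U' := ⟨e2, by rw [e1]; exact hR⟩
  have hP : IsPath r C U' := by
    constructor
    · intro k
      rcases eq_or_ne k (j + 1) with rfl | hk
      · rw [e1]; exact hF
      · rw [e2 k hk]; exact hU.fits k
    · intro k
      rcases eq_or_ne k (j + 1) with rfl | hk
      · rw [e1, e2 _ (by omega)]; exact hst.2
      · rw [e2 k hk]
        rcases eq_or_ne k j with rfl | hk'
        · rw [e1]; exact hst.1
        · rw [e2 _ (by omega)]; exact hU.strip k
  -- Termination: the raised path has one more box at index `j + 1 < p`, in a column between `1` and
  -- `C`.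
  have hlt : ∑ k ∈ Finset.range p, ∑ w ∈ Finset.Icc 1 C, (r - U' k w).toNat <
      ∑ k ∈ Finset.range p, ∑ w ∈ Finset.Icc 1 C, (r - U k w).toNat := by
    have hle : ∀ w, U (j + 1) w ≤ L' w := fun w => by
      rw [hL']
      rcases eq_or_ne w x with rfl | hw
      · simp
      · simp [hw]
    have hbd : L' x ≤ r := by
      have := hst.2.antitone_left hx0.le
      rwa [hF.1 0 le_rfl] at this
    have hx1 : L' x = U (j + 1) x + 1 := by simp [hL']
    refine Finset.sum_lt_sum (fun k _ => Finset.sum_le_sum fun w _ => ?_)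
      ⟨j + 1, by simp; omega, Finset.sum_lt_sum (fun w _ => ?_) ⟨x, by simp; omega, ?_⟩⟩
    · rcases eq_or_ne k (j + 1) with rfl | hk
      · rw [e1]; have := hle w; omega
      · rw [e2 k hk]
    · rw [e1]; have := hle w; omega
    · rw [e1]; omega
  have ih := slides_apply hC ht hm U' hP (by rw [e2 0 (by omega), h])
    (by rw [e2 p (by omega)]; exact hp) v
  rw [e2 0 (by omega), (hmove.slide_iter hU ht h m).eq p (by omega)] at ih
  exact ih
termination_by ∑ k ∈ Finset.range p, ∑ w ∈ Finset.Icc 1 C, (r - U k w).toNat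

/-! ### From tuples to column heights. -/

/-- The conjugate of a shape: `conj f v` is the number of rows with an entry at least `v`. -/
def conj {r : ℕ} (f : Fin r → ℤ) (v : ℤ) : ℤ := ∑ i, if v ≤ f i then 1 else 0

theorem conj_sortDesc {r : ℕ} (a : Fin r → ℤ) : conj (sortDesc a) = conj a := by
  funext v
  exact Equiv.sum_comp (Fin.revPerm.trans (Tuple.sort a)) fun i => if v ≤ a i then (1 : ℤ) else 0

/-- Superlevel sets of antitone tuples are initial segments, hence nested. Thus minima and maxima of
column heights count intersections and unions. -/
theorem chain_of_antitone {r : ℕ} {f g : Fin r → ℤ} (hf : Antitone f) (hg : Antitone g)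
    (v w : ℤ) : (∀ i, v ≤ f i → w ≤ g i) ∨ ∀ i, w ≤ g i → v ≤ f i := by
  by_contra! h
  obtain ⟨⟨i, hi, hi'⟩, j, hj, hj'⟩ := h
  rcases le_total i j with h | h
  · have := hg h; omega
  · have := hf h; omega

theorem sum_ite_le_sum_ite {ι : Type*} [Fintype ι] {p q : ι → Prop} [DecidablePred p]
    [DecidablePred q] (h : ∀ i, p i → q i) :
    (∑ i, if p i then (1 : ℤ) else 0) ≤ ∑ i, if q i then 1 else 0 := by
  refine Finset.sum_le_sum fun i _ => ?_
  have := h i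
  split_ifs <;> simp_all

theorem min_conj {r : ℕ} {f g : Fin r → ℤ} (hf : Antitone f) (hg : Antitone g) (v w : ℤ) :
    min (conj f v) (conj g w) = ∑ i, if v ≤ f i ∧ w ≤ g i then 1 else 0 := by
  rw [conj, conj]
  rcases chain_of_antitone hf hg v w with h | h
  · rw [min_eq_left (sum_ite_le_sum_ite h)]
    exact Finset.sum_congr rfl fun i _ => by simp only [and_iff_left_of_imp (h i)]
  · rw [min_eq_right (sum_ite_le_sum_ite h)]
    exact Finset.sum_congr rfl fun i _ => by simp only [and_iff_right_of_imp (h i)]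

theorem max_conj {r : ℕ} {f g : Fin r → ℤ} (hf : Antitone f) (hg : Antitone g) (v w : ℤ) :
    max (conj f v) (conj g w) = ∑ i, if v ≤ f i ∨ w ≤ g i then 1 else 0 := by
  rw [conj, conj]
  rcases chain_of_antitone hf hg v w with h | h
  · rw [max_eq_right (sum_ite_le_sum_ite h)]
    exact Finset.sum_congr rfl fun i _ => by simp only [or_iff_right_of_imp (h i)]
  · rw [max_eq_left (sum_ite_le_sum_ite h)]
    exact Finset.sum_congr rfl fun i _ => by simp only [or_iff_left_of_imp (h i)]

theorem le_of_conj_le {r : ℕ} {f g : Fin r → ℤ} (hf : Antitone f) (hg : Antitone g)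
    (h : conj g ≤ conj f) : g ≤ f := by
  intro i
  by_contra hi
  replace hi : f i < g i := not_le.1 hi
  -- At height `g i`, every row counted for `f` lies above row `i` and so is counted for `g`; row
  -- `i` is counted for `g` only.
  refine absurd (h (g i)) (not_le.2 (Finset.sum_lt_sum (fun j _ => ?_) ⟨i, Finset.mem_univ i, ?_⟩))
  · split_ifs with h1 h2 h2
    · exact le_rfl
    · rcases le_total i j with hij | hij
      · have := hf hij; omega
      · exact absurd (hg hij) h2
    · exact zero_le_one
    · exact le_rfl
  · rw [if_neg (by omega), if_pos le_rfl]
    exact zero_lt_one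

theorem eq_of_conj_eq {r : ℕ} {f g : Fin r → ℤ} (hf : Antitone f) (hg : Antitone g)
    (h : conj f = conj g) : f = g :=
  le_antisymm (le_of_conj_le hg hf h.le) (le_of_conj_le hf hg h.ge)

theorem sortDesc_eq_of_conj_eq {r : ℕ} {a f : Fin r → ℤ} (hf : Antitone f)
    (h : conj a = conj f) : sortDesc a = f :=
  eq_of_conj_eq (antitone_sortDesc a) hf ((conj_sortDesc a).trans h)

theorem sortDesc_add_const {r : ℕ} (a : Fin r → ℤ) (c : ℤ) :
    sortDesc (fun i => a i + c) = fun i => sortDesc a i + c := by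
  refine sortDesc_eq_of_conj_eq (fun i j h => by have := antitone_sortDesc a h; simpa) ?_
  funext v
  have := congrFun (conj_sortDesc a) (v - c)
  simp only [conj, sub_le_iff_le_add] at this
  exact this.symm

/-- The shape `g` is obtained from `f` by adding a column strip. -/
def AddsColumn {r : ℕ} (f g : Fin r → ℤ) : Prop := ∀ i, f i ≤ g i ∧ g i ≤ f i + 1

theorem AddsColumn.strip {r : ℕ} {f g : Fin r → ℤ} (h : AddsColumn f g) :
    Strip (conj f) (conj g) := fun v =>
  ⟨sum_ite_le_sum_ite fun i hi => hi.trans (h i).1,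
    sum_ite_le_sum_ite fun i hi => by have := (h i).2; omega⟩

theorem AddsColumn.localRule {r : ℕ} {lam nu kap : Fin r → ℤ} (hn : Antitone nu)
    (hk : Antitone kap) (h1 : AddsColumn kap lam) (h2 : AddsColumn lam nu) :
    AddsColumn kap (localRule lam nu kap) ∧ AddsColumn (localRule lam nu kap) nu := by
  have e1 : sortDesc kap = kap := sortDesc_of_antitone hk
  have e2 : sortDesc nu = nu := sortDesc_of_antitone hn
  have e3 := sortDesc_add_const kap 1
  have e4 := sortDesc_add_const nu (-1)
  rw [e1] at e3
  rw [e2] at e4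
  have i1 : kap ≤ Fluctuating.localRule lam nu kap := by
    conv_lhs => rw [← e1]
    rw [Fluctuating.localRule]
    exact sortDesc_mono fun i => by have := h2 i; simp; omega
  have i2 : Fluctuating.localRule lam nu kap ≤ fun i => kap i + 1 := by
    rw [← e3, Fluctuating.localRule]
    exact sortDesc_mono fun i => by have := h2 i; simp; omega
  have i3 : Fluctuating.localRule lam nu kap ≤ nu := by
    conv_rhs => rw [← e2]
    rw [Fluctuating.localRule]
    exact sortDesc_mono fun i => by have := h1 i; simp; omega
  have i4 : (fun i => nu i + -1) ≤ Fluctuating.localRule lam nu kap := by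
    rw [← e4, Fluctuating.localRule]
    exact sortDesc_mono fun i => by have := h1 i; simp; omega
  exact ⟨fun i => ⟨i1 i, i2 i⟩, fun i => ⟨i3 i, by have := i4 i; simp only at this; omega⟩⟩

/-- Column heights do not see the sorting, so the identity can be checked row by row, where each
step adds `0` or `1`. -/
theorem conj_localRule {r : ℕ} {lam nu kap : Fin r → ℤ} (hn : Antitone nu)
    (hk : Antitone kap) (h1 : AddsColumn kap lam) (h2 : AddsColumn lam nu) :
    conj (localRule lam nu kap) = toggle (conj kap) (conj lam) (conj nu) := by
  rw [localRule, conj_sortDesc]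
  funext v
  rw [toggle, min_conj hn hk, max_conj hn hk, eq_sub_iff_add_eq, conj, conj,
    ← Finset.sum_add_distrib, ← Finset.sum_add_distrib]
  refine Finset.sum_congr rfl fun i _ => ?_
  have := h1 i
  have := h2 i
  simp only [Pi.add_apply, Pi.sub_apply]
  split_ifs <;> omega

theorem conj_fits {r : ℕ} {f : Fin r → ℤ} {C : ℤ} (h : ∀ i, 0 ≤ f i ∧ f i ≤ C) :
    Fits r C (conj f) := by
  constructor <;> intro v hv
  · rw [conj, Finset.sum_congr rfl fun i _ => if_pos (by have := h i; omega)]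
    simp
  · rw [conj, Finset.sum_congr rfl fun i _ => if_neg (by have := h i; omega)]
    simp

/-! ### The last column of the growth diagram. -/

theorem addsColumn_growth {r : ℕ} {T : ℕ → Fin r → ℤ} (hT : ∀ k, Antitone (T k))
    (hs : ∀ k, AddsColumn (T k) (T (k + 1))) (i : ℕ) :
    (∀ k, AddsColumn (growth T i k) (growth T i (k + 1))) ∧
      ∀ k, AddsColumn (growth T (i + 1) k) (growth T i (k + 1)) := by
  have step : ∀ i, (∀ k, AddsColumn (growth T i k) (growth T i (k + 1))) →
      ∀ k, AddsColumn (growth T (i + 1) k) (growth T i (k + 1)) := by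
    intro i hi k
    induction k with
    | zero =>
      have := hi 0
      rw [growth_diag] at this ⊢
      exact this
    | succ k ih =>
      rw [growth]
      exact (ih.localRule (antitone_growth hT _ _) (antitone_growth hT _ _) (hi (k + 1))).2
  have hor : ∀ i k, AddsColumn (growth T i k) (growth T i (k + 1)) := by
    intro i
    induction i with
    | zero => simpa [growth] using hs
    | succ i hi =>
      intro k
      rw [growth]
      exact ((step i hi k).localRule (antitone_growth hT _ _) (antitone_growth hT _ _)
        (hi (k + 1))).1
  exact ⟨hor i, step i (hor i)⟩

/-- The right column of the evacuation diagram of a rectangle filled by adding columns. -/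
theorem growth_of_addsColumn {r : ℕ} {T : ℕ → Fin r → ℤ} {n : ℕ} {c : ℤ}
    (hT : ∀ k, Antitone (T k)) (hs : ∀ k, AddsColumn (T k) (T (k + 1))) (h0 : T 0 = 0)
    (hn : ∀ k, n ≤ k → T k = fun _ => c) {m : ℕ} (hm : m ≤ n) :
    growth T m (n - m) = fun i => c - T m i.rev := by
  rcases r.eq_zero_or_pos with rfl | hr
  · exact Subsingleton.elim _ _
  have hg := addsColumn_growth hT hs
  have nonneg : ∀ i k a, 0 ≤ growth T i k a := by
    intro i k a
    induction k with
    | zero => rw [growth_diag, h0]; exact le_rfl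
    | succ k ih => exact ih.trans ((hg i).1 k a).1
  have Tle : ∀ k a, T k a ≤ c := by
    intro k a
    have : ∀ l, T k a ≤ T (k + l) a := by
      intro l
      induction l with
      | zero => exact le_rfl
      | succ l ih => exact ih.trans (hs (k + l) a).1
    have := this n
    rwa [hn (k + n) (by omega)] at this
  have le : ∀ i k a, growth T i k a ≤ c := by
    intro i
    induction i with
    | zero => simpa [growth] using Tle
    | succ i ih => exact fun k a => ((hg i).2 k a).1.trans (ih (k + 1) a)
  have hc : 0 ≤ c := (nonneg 0 0 ⟨0, hr⟩).trans (le 0 0 _)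
  have fits : ∀ i k, Fits r c (conj (growth T i k)) := fun i k =>
    conj_fits fun a => ⟨nonneg i k a, le i k a⟩
  -- The chain is column `m` of the diagram read downwards from `λ^m` to the empty shape; truncated
  -- subtraction makes it constant after that.
  have chain : IsChain r c fun i => conj (growth T i (m - i)) := by
    refine ⟨fun i => fits _ _, fun i => AddsColumn.strip ?_⟩
    rcases lt_or_ge i m with h | h
    · have := (hg i).2 (m - (i + 1))
      rwa [show m - (i + 1) + 1 = m - i by omega] at this
    · rw [show m - (i + 1) = 0 by omega, show m - i = 0 by omega, growth_diag, growth_diag]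
      exact fun a => ⟨le_rfl, by omega⟩
  have path : IsPath r c fun k => conj (T (m + k)) :=
    ⟨fun k => by simpa [growth] using fits 0 (m + k), fun k => (hs (m + k)).strip⟩
  have slide : ∀ i ≤ m, ∀ k, slides (fun i => conj (growth T i (m - i)))
      (fun k => conj (T (m + k))) i k = conj (growth T i (m - i + k)) := by
    intro i hi
    induction i with
    | zero => intro k; rw [slides, growth]; rfl
    | succ i ih =>
      intro k
      induction k with
      | zero => rfl
      | succ k ihk =>
        rw [slides_succ, ihk, ih (by omega), ih (by omega)]
        obtain ⟨l, hl⟩ : ∃ l, m - i = l + 1 := ⟨m - i - 1, by omega⟩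
        rw [hl, show m - (i + 1) = l by omega, show l + 1 + k = l + k + 1 by omega,
          show l + 1 + (k + 1) = l + k + 2 by omega, ← add_assoc, growth]
        exact (conj_localRule (antitone_growth hT _ _) (antitone_growth hT _ _)
          ((hg i).2 (l + k)) ((hg i).1 (l + k + 1))).symm
  refine eq_of_conj_eq (antitone_growth hT _ _)
    (fun a b h => sub_le_sub_left (hT m (Fin.rev_le_rev.2 h)) c) ?_
  funext v
  have key := slides_apply hc chain (m := m) (p := n - m) (fun v hv => ?_)
    (fun k => conj (T (m + k))) path (by simp [growth]) (fun v hv => ?_) v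
  · rw [slide m le_rfl, Nat.sub_self, zero_add] at key
    rw [key, conj, conj, sub_eq_iff_eq_add, ← Equiv.sum_comp Fin.revPerm (fun i => ite _ _ _),
      ← Finset.sum_add_distrib]
    rw [Finset.sum_congr rfl fun i _ => (?_ : _ = (1 : ℤ))]
    · simp
    · simp only [Fin.revPerm_apply, Fin.rev_rev, add_zero]
      split_ifs <;> omega
  · simp only [Nat.sub_self, growth_diag, h0]
    rw [conj, Finset.sum_congr rfl fun i _ => if_neg (by simpa using hv)]
    simp
  · rw [hn _ (by omega), conj, Finset.sum_congr rfl fun i _ => if_pos hv]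
    simp

theorem growth_add_const {r : ℕ} (T : ℕ → Fin r → ℤ) {s : ℕ → ℤ} (hs : s 0 = 0) (i k : ℕ) :
    growth (fun k a => T k a + s k) i k = fun a => growth T i k a + (s (i + k) - s i) := by
  induction i generalizing k with
  | zero => simp [growth, hs]
  | succ i ih =>
    induction k with
    | zero => simp [growth, hs]
    | succ k ihk =>
      rw [growth, growth, localRule, localRule, ih, ih, ihk, ← sortDesc_add_const]
      congr 1
      funext a
      simp only [Pi.add_apply, Pi.sub_apply]
      rw [show i + 1 + (k + 1) = i + (k + 2) by omega, show i + 1 + k = i + (k + 1) by omega]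
      ring

/-- Removing a column and then adding `1` to every row is the same as adding the complementary
column; `s k` accumulates these shifts, which cancel from the final identity. -/
theorem growth_eq_compl {r : ℕ} {T : ℕ → Fin r → ℤ} {n : ℕ} {c : ℤ}
    (hT : ∀ k, Antitone (T k)) (hs : ∀ k, SkewColumn (T k) (T (k + 1))) (h0 : T 0 = 0)
    (hn : ∀ k, n ≤ k → T k = fun _ => c) {m : ℕ} (hm : m ≤ n) :
    growth T m (n - m) = fun i => c - T m i.rev := by
  have hshift : ∀ k, ∃ e : ℤ, AddsColumn (T k) (fun a => T (k + 1) a + e) ∧ (n ≤ k → e = 0) := by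
    intro k
    rcases lt_or_ge k n with hk | hk
    · rcases (skewColumn_iff _ _).1 (hs k) with ⟨h1, h2⟩ | ⟨h1, h2⟩
      · exact ⟨0, fun a => ⟨by simpa using h1 a, by simpa using h2 a⟩, by omega⟩
      · exact ⟨1, fun a => ⟨by simpa using h2 a, by simpa using h1 a⟩, by omega⟩
    · refine ⟨0, fun a => ?_, fun _ => rfl⟩
      rw [hn k hk, hn (k + 1) (by omega)]
      simp
  choose e he he' using hshift
  set s : ℕ → ℤ := fun k => ∑ i ∈ Finset.range k, e i with hsdef
  have s_succ : ∀ k, s (k + 1) = s k + e k := fun k => Finset.sum_range_succ _ _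
  have s_const : ∀ l, s (n + l) = s n := by
    intro l
    induction l with
    | zero => rfl
    | succ l ih => rw [← add_assoc, s_succ, ih, he' _ (by omega), add_zero]
  have s0 : s 0 = 0 := by simp [s]
  have key := growth_of_addsColumn (T := fun k a => T k a + s k) (n := n) (c := c + s n)
    (fun k a b h => by simpa using hT k h)
    (fun k a => by
      have := he k a
      simp only [s_succ] at *
      omega)
    (by funext a; simp [h0, s0])
    (fun k hk => by
      obtain ⟨l, rfl⟩ := Nat.exists_eq_add_of_le hk
      funext a
      rw [hn _ hk, s_const]) hm
  rw [growth_add_const T s0, Nat.add_sub_cancel' hm] at key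
  funext a
  have := congrFun key a
  omega

theorem Letter.vec_compl {r : ℕ} (S : Letter r) (j : Fin r) : S.compl.vec j = S.vec j.rev := by
  have hj : ((j.rev : ℕ) : ℤ) = r - j - 1 := by
    rw [Fin.val_rev]
    have := j.2
    omega
  have h1 : ((j : ℕ) : ℤ) + 1 ∈ S.compl.1 ↔ ((j.rev : ℕ) : ℤ) + 1 ∈ S.1 := by
    rw [hj]
    simp only [Letter.compl, Finset.mem_image]
    constructor
    · rintro ⟨x, hx, h⟩
      obtain ⟨a, b⟩ := S.2.1 x hx
      rcases lt_trichotomy x 0 with h0 | rfl | h0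
      · rw [Int.sign_eq_neg_one_of_neg h0] at h; omega
      · simp at a
      · rw [Int.sign_eq_one_of_pos h0, abs_of_pos h0] at h
        rwa [show (r : ℤ) - j - 1 + 1 = x by omega]
    · intro hx
      refine ⟨_, hx, ?_⟩
      have := j.2
      rw [Int.sign_eq_one_of_pos (by omega), abs_of_pos (by omega)]
      ring
  have h2 : -(((j : ℕ) : ℤ) + 1) ∈ S.compl.1 ↔ -(((j.rev : ℕ) : ℤ) + 1) ∈ S.1 := by
    rw [hj]
    simp only [Letter.compl, Finset.mem_image]
    constructor
    · rintro ⟨x, hx, h⟩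
      obtain ⟨a, b⟩ := S.2.1 x hx
      rcases lt_trichotomy x 0 with h0 | rfl | h0
      · rw [Int.sign_eq_neg_one_of_neg h0, abs_of_neg h0] at h
        rwa [show -((r : ℤ) - j - 1 + 1) = x by omega]
      · simp at a
      · rw [Int.sign_eq_one_of_pos h0] at h; omega
    · intro hx
      refine ⟨_, hx, ?_⟩
      have := j.2
      rw [Int.sign_eq_neg_one_of_neg (by omega), abs_of_neg (by omega)]
      ring
  simp only [Letter.vec, h1, h2]

/-! ### Evacuation and promotion. -/

namespace SkewTableau

theorem shapes_coe {r n : ℕ} (T : SkewTableau r n) (k : Fin (n + 1)) :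
    T.shapes k = T.shape k :=
  congrArg T.shape (Fin.ext (by simp; omega))

theorem shapes_of_le {r n : ℕ} (T : SkewTableau r n) {k : ℕ} (hk : n ≤ k) :
    T.shapes k = T.shape (Fin.last n) :=
  congrArg T.shape (Fin.ext (by simp; omega))

theorem IsRectangular.growth_shapes {r n : ℕ} {T : SkewTableau r n} (hT : T.IsRectangular)
    {m : ℕ} (hm : m ≤ n) :
    growth T.shapes m (n - m) = fun i => T.shape (Fin.last n) i - T.shapes m i.rev := by
  rcases r.eq_zero_or_pos with rfl | hr
  · exact Subsingleton.elim _ _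
  have hc : T.shape (Fin.last n) = fun _ => T.shape (Fin.last n) ⟨0, hr⟩ :=
    funext fun i => hT.2 i _
  rw [growth_eq_compl T.antitone_shapes T.skewColumn_shapes
    ((T.shapes_coe 0).trans hT.1) (fun k hk => (T.shapes_of_le hk).trans hc) hm]
  funext i
  rw [hT.2 i]

theorem IsRectangular.latticeWord_evacuation {r n : ℕ} {T : SkewTableau r n}
    (hT : T.IsRectangular) : T.evacuation.latticeWord = reverseComplement T.latticeWord := by
  have shape_eq : ∀ k : Fin (n + 1), T.evacuation.shape k =
      fun i => T.shape (Fin.last n) i - T.shape k.rev i.rev := by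
    intro k
    have h := hT.growth_shapes (m := n - k) (by omega)
    rw [show n - (n - (k : ℕ)) = k by omega] at h
    have e : n - (k : ℕ) = (k.rev : ℕ) := by rw [Fin.val_rev]; omega
    rw [e, shapes_coe, ← e] at h
    exact h
  funext i
  rw [latticeWord_eq_iff, shape_eq, shape_eq]
  funext a
  have h := congrFun ((T.latticeWord_eq_iff i.rev _).1 rfl) a.rev
  rw [Pi.add_apply] at h
  rw [Pi.add_apply, reverseComplement, Letter.vec_compl, Fin.rev_castSucc, Fin.rev_succ, h]
  ring

theorem shape_last_promotion {r n : ℕ} (T : SkewTableau r n) :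
    T.promotion.shape (Fin.last n) = T.shape (Fin.last n) := by
  simp [promotion]

theorem shapes_promotion {r n : ℕ} (T : SkewTableau r n) {k : ℕ} (hk : k < n) :
    T.promotion.shapes k = growth T.shapes 1 k := by
  have : T.promotion.shapes k = T.promotion.shape ⟨k, by omega⟩ :=
    T.promotion.shapes_coe ⟨k, by omega⟩
  rw [this, promotion]
  exact if_pos hk

theorem IsRectangular.promotion {r n : ℕ} {T : SkewTableau r n} (hT : T.IsRectangular) :
    T.promotion.IsRectangular := by
  refine ⟨?_, by rw [shape_last_promotion]; exact hT.2⟩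
  rcases n.eq_zero_or_pos with rfl | hn
  · exact T.shape_last_promotion.trans hT.1
  · rw [← shapes_coe]
    exact (T.shapes_promotion hn).trans ((growth_diag _ _).trans ((T.shapes_coe 0).trans hT.1))

theorem IsRectangular.iterate_promotion {r n : ℕ} {T : SkewTableau r n} (hT : T.IsRectangular)
    (j : ℕ) : (SkewTableau.promotion^[j] T).IsRectangular := by
  induction j with
  | zero => exact hT
  | succ j ih => rw [Function.iterate_succ_apply']; exact ih.promotion

theorem shape_last_iterate_promotion {r n : ℕ} (T : SkewTableau r n) (j : ℕ) :
    (SkewTableau.promotion^[j] T).shape (Fin.last n) = T.shape (Fin.last n) := by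
  induction j with
  | zero => rfl
  | succ j ih => rw [Function.iterate_succ_apply', shape_last_promotion, ih]

/-- Row `1` of the diagram of `T` is the top row for its promotion. The bound excludes the appended
last shape `λ^n`, which is not an entry of that row. -/
theorem growth_shapes_promotion {r n : ℕ} (T : SkewTableau r n) {j k : ℕ} (h : j + k < n) :
    growth T.promotion.shapes j k = growth T.shapes (j + 1) k := by
  induction j generalizing k with
  | zero => rw [growth]; exact T.shapes_promotion (by omega)
  | succ j ih =>
    induction k with
    | zero =>
      rw [growth_diag, growth_diag, T.shapes_promotion (by omega), growth_diag]
    | succ k ihk =>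
      rw [growth, growth, ih (by omega), ih (by omega), ihk (by omega)]

theorem shapes_iterate_promotion {r n : ℕ} (T : SkewTableau r n) {j k : ℕ} (h : j + k ≤ n) :
    (SkewTableau.promotion^[j] T).shapes k = growth T.shapes j k := by
  induction j generalizing T with
  | zero => rw [growth]; rfl
  | succ j ih =>
    rw [Function.iterate_succ_apply, ih _ (by omega), growth_shapes_promotion _ (by omega)]

theorem IsRectangular.iterate_promotion_eq {r n : ℕ} {T : SkewTableau r n}
    (hT : T.IsRectangular) : SkewTableau.promotion^[n] T = T := by
  ext1
  funext k
  have hk : (k : ℕ) ≤ n := by omega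
  rw [← shapes_coe, ← T.shapes_coe]
  -- Split `𝒫^n` as `𝒫^{n-k} ∘ 𝒫^k`: shape `k` of `𝒫^n(T)` is the complement of shape `n - k` of
  -- `𝒫^k(T)`, which is `λ^{k,n}`, itself the complement of `λ^k`.
  have h1 := (hT.iterate_promotion k).growth_shapes (m := n - k) (by omega)
  rw [show n - (n - (k : ℕ)) = k by omega, ← shapes_iterate_promotion _ (by omega),
    ← Function.iterate_add_apply, Nat.sub_add_cancel hk, shape_last_iterate_promotion,
    shapes_iterate_promotion (j := k) (k := n - k) _ (by omega), hT.growth_shapes hk] at h1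
  rw [h1]
  funext i
  dsimp only
  rw [Fin.rev_rev, hT.2 i.rev i]
  ring

end SkewTableau

end Fluctuating

theorem theorem5p4 (r n : ℕ) (T : Fluctuating.SkewTableau r n) (hT : T.IsRectangular) :
    Fluctuating.SkewTableau.promotion^[n] T = T ∧
      T.evacuation.latticeWord = Fluctuating.reverseComplement T.latticeWord :=
  ⟨hT.iterate_promotion_eq, hT.latticeWord_evacuation⟩
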